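/- Let $X$ be a real Banach space of dimension $2$, and let $c_0$ be the Banach space of real sequences converging to $0$ with the supremum norm. Let $c_0\widehat{\otimes}_\pi X$ be the projective tensor product, i.e. the completion of the algebraic tensor product $c_0\otimes X$ with respect to the norm $$\|u\|_\pi=\inf\Big\{\sum_{i=1}^n\|a_i\|\,\|x_i\| : n\in\mathbb N,\ u=\sum_{i=1}^n a_i\otimes x_i,\ a_i\in c_0,\ x_i\in X\Big\}.$$ Then $Z=c_0\widehat{\otimes}_\pi X$ has the strong diameter two property: every convex combination of slices of its closed unit ball $B_Z$ has diameter two. That is, for every $n\ge 1$, all $\lambda_1,\dots,\lambda_n\ge 0$ with $\sum_{i=1}^n\lambda_i=1$, all $f_1,\dots,f_n\in Z^*$ with $\|f_i\|=1$ and all $\alpha_1,\dots,\alpha_n>0$, the set $$\Big\{\sum_{i=1}^n\lambda_i z_i : z_i\in B_Z,\ f_i(z_i)>1-\alpha_i \text{ for } i=1,\dots,n\Big\}$$ has diameter $2$. -/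

import Mathlib

open scoped TensorProduct ZeroAtInfty

section ProjectiveNorm

variable {E : Type*} {F : Type*} [NormedAddCommGroup E] [NormedSpace ℝ E]
  [NormedAddCommGroup F] [NormedSpace ℝ F]

/-- The set of all values `∑ ‖x i‖ * ‖y i‖` over the finite representations
`u = ∑ x i ⊗ y i` of the tensor `u`. -/
def projectiveCosts (u : E ⊗[ℝ] F) : Set ℝ :=
  {r | ∃ (n : ℕ) (x : Fin n → E) (y : Fin n → F),
    u = ∑ i, x i ⊗ₜ[ℝ] y i ∧ r = ∑ i, ‖x i‖ * ‖y i‖}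

/-- The projective norm `π(u) = inf {∑ ‖x i‖ * ‖y i‖ : u = ∑ x i ⊗ y i}`. -/
noncomputable def projectiveNorm (u : E ⊗[ℝ] F) : ℝ :=
  sInf (projectiveCosts u)

theorem projectiveCosts_nonneg {u : E ⊗[ℝ] F} {r : ℝ} (hr : r ∈ projectiveCosts u) :
    0 ≤ r := by
  obtain ⟨n, x, y, -, rfl⟩ := hr
  positivity

theorem projectiveCosts_bddBelow (u : E ⊗[ℝ] F) : BddBelow (projectiveCosts u) :=
  ⟨0, fun _ hr => projectiveCosts_nonneg hr⟩

theorem projectiveCosts_zero : (0 : ℝ) ∈ projectiveCosts (0 : E ⊗[ℝ] F) :=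
  ⟨0, Fin.elim0, Fin.elim0, by simp, by simp⟩

theorem projectiveCosts_tmul (x : E) (y : F) : ‖x‖ * ‖y‖ ∈ projectiveCosts (x ⊗ₜ[ℝ] y) :=
  ⟨1, fun _ => x, fun _ => y, by simp, by simp⟩

theorem projectiveCosts_add {u v : E ⊗[ℝ] F} {r s : ℝ} (hr : r ∈ projectiveCosts u)
    (hs : s ∈ projectiveCosts v) : r + s ∈ projectiveCosts (u + v) := by
  obtain ⟨n, x, y, rfl, rfl⟩ := hr
  obtain ⟨m, x', y', rfl, rfl⟩ := hs
  exact ⟨n + m, Fin.append x x', Fin.append y y', by simp [Fin.sum_univ_add],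
    by simp [Fin.sum_univ_add]⟩

theorem projectiveCosts_smul (c : ℝ) {u : E ⊗[ℝ] F} {r : ℝ} (hr : r ∈ projectiveCosts u) :
    ‖c‖ * r ∈ projectiveCosts (c • u) := by
  obtain ⟨n, x, y, rfl, rfl⟩ := hr
  refine ⟨n, fun i => c • x i, y, ?_, ?_⟩
  · simp [Finset.smul_sum, TensorProduct.smul_tmul']
  · simp [Finset.mul_sum, norm_smul, mul_assoc]

theorem projectiveCosts_nonempty (u : E ⊗[ℝ] F) : (projectiveCosts u).Nonempty := by
  induction u using TensorProduct.induction_on with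
  | zero => exact ⟨0, projectiveCosts_zero⟩
  | tmul x y => exact ⟨_, projectiveCosts_tmul x y⟩
  | add u v hu hv =>
    obtain ⟨r, hr⟩ := hu
    obtain ⟨s, hs⟩ := hv
    exact ⟨_, projectiveCosts_add hr hs⟩

theorem projectiveNorm_zero : projectiveNorm (0 : E ⊗[ℝ] F) = 0 :=
  le_antisymm (csInf_le (projectiveCosts_bddBelow _) projectiveCosts_zero)
    (le_csInf (projectiveCosts_nonempty _) fun _ hr => projectiveCosts_nonneg hr)

theorem projectiveNorm_add_le (u v : E ⊗[ℝ] F) :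
    projectiveNorm (u + v) ≤ projectiveNorm u + projectiveNorm v := by
  refine le_of_forall_pos_le_add fun ε hε => ?_
  obtain ⟨r, hr, hr'⟩ := exists_lt_of_csInf_lt (projectiveCosts_nonempty u)
    (show projectiveNorm u < projectiveNorm u + ε / 2 by linarith)
  obtain ⟨s, hs, hs'⟩ := exists_lt_of_csInf_lt (projectiveCosts_nonempty v)
    (show projectiveNorm v < projectiveNorm v + ε / 2 by linarith)
  have h : projectiveNorm (u + v) ≤ r + s :=
    csInf_le (projectiveCosts_bddBelow _) (projectiveCosts_add hr hs)
  linarith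

theorem projectiveNorm_smul_le (c : ℝ) (u : E ⊗[ℝ] F) :
    projectiveNorm (c • u) ≤ ‖c‖ * projectiveNorm u := by
  rcases eq_or_ne c 0 with rfl | hc
  · simp [projectiveNorm_zero]
  · have hc' : 0 < ‖c‖ := norm_pos_iff.mpr hc
    rw [← div_le_iff₀' hc']
    refine le_csInf (projectiveCosts_nonempty u) fun r hr => ?_
    rw [div_le_iff₀' hc']
    exact csInf_le (projectiveCosts_bddBelow _) (projectiveCosts_smul c hr)

/-- The projective norm as a seminorm on the algebraic tensor product. -/
noncomputable def projectiveSeminorm : Seminorm ℝ (E ⊗[ℝ] F) :=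
  Seminorm.ofSMulLE projectiveNorm projectiveNorm_zero projectiveNorm_add_le
    projectiveNorm_smul_le

end ProjectiveNorm

section ProjectiveTensorProduct

variable (E : Type*) (F : Type*) [NormedAddCommGroup E] [NormedSpace ℝ E]
  [NormedAddCommGroup F] [NormedSpace ℝ F]

/-- The algebraic tensor product `E ⊗ F`, as a type that carries the projective norm. -/
def AlgProjectiveTensor : Type _ := E ⊗[ℝ] F

noncomputable instance AlgProjectiveTensor.instAddCommGroup :
    AddCommGroup (AlgProjectiveTensor E F) :=
  inferInstanceAs (AddCommGroup (E ⊗[ℝ] F))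

noncomputable instance AlgProjectiveTensor.instModule :
    Module ℝ (AlgProjectiveTensor E F) :=
  inferInstanceAs (Module ℝ (E ⊗[ℝ] F))

noncomputable instance AlgProjectiveTensor.instSeminormedAddCommGroup :
    SeminormedAddCommGroup (AlgProjectiveTensor E F) :=
  AddGroupSeminorm.toSeminormedAddCommGroup
    (E := AlgProjectiveTensor E F) (projectiveSeminorm (E := E) (F := F)).toAddGroupSeminorm

noncomputable instance AlgProjectiveTensor.instNormedSpace :
    NormedSpace ℝ (AlgProjectiveTensor E F) where
  norm_smul_le c u := projectiveNorm_smul_le (E := E) (F := F) c u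

/-- The projective tensor product `E ⊗̂_π F`: the completion of `E ⊗ F` for the projective
norm. -/
abbrev ProjectiveTensorProduct : Type _ :=
  UniformSpace.Completion (AlgProjectiveTensor E F)

end ProjectiveTensorProduct

section DiameterTwo

variable {E : Type*} [NormedAddCommGroup E] [NormedSpace ℝ E]

/-- The slice `{x ∈ B_E : f x > 1 - α}` of the closed unit ball of `E`, for a functional `f`
of norm one. -/
def unitBallSlice (f : E →L[ℝ] ℝ) (α : ℝ) : Set E :=
  {x | x ∈ Metric.closedBall (0 : E) 1 ∧ 1 - α < f x}

/-- `S` is a slice of the closed unit ball of `E`. -/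
def IsUnitBallSlice (S : Set E) : Prop :=
  ∃ (f : E →L[ℝ] ℝ) (α : ℝ), ‖f‖ = 1 ∧ 0 < α ∧ S = unitBallSlice f α

/-- The combination `∑ w i • S i = {∑ w i • x i : x i ∈ S i}` of finitely many sets. -/
def setCombination {n : ℕ} (w : Fin n → ℝ) (S : Fin n → Set E) : Set E :=
  {z | ∃ x : Fin n → E, (∀ i, x i ∈ S i) ∧ z = ∑ i, w i • x i}

variable (E) in
/-- The strong diameter two property: every convex combination of slices of the closed unit
ball has diameter two. -/
def StrongDiameterTwoProperty : Prop :=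
  ∀ (n : ℕ) (w : Fin n → ℝ) (S : Fin n → Set E),
    (∀ i, 0 ≤ w i) → ∑ i, w i = 1 → (∀ i, IsUnitBallSlice (S i)) →
      Metric.diam (setCombination w S) = 2

end DiameterTwo

/-! In dimension two, any finite set of points x_i admits functionals g_j with ∑ |g_j y| ≤ ‖y‖ for
all y and equality at each x_i: take half the increments of norming functionals around half an
ellipse (`exists_sum_abs_le_norm`).

Each slice contains an elementary tensor a_i ⊗ x_i with factors in the unit balls and ‖x_i‖ near 1.
Since a functional on c₀ has summable coefficients, a_i may be overwritten by ± sign g_j(x_i) on a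
remote block of coordinates N + j without leaving the slice. The form ∑ e*_{N+j} ⊗ g_j is bounded by
the projective norm and equals ±‖x_i‖ on the two modified tensors. The two resulting combinations
are therefore almost 2 apart. -/

/-! ### Planar norms and ℓ₁-sums of functionals -/

theorem sum_abs_sub_le_of_unimodal {f u : ℕ → ℝ} {s M : ℝ} {m : ℕ}
    (hu : Monotone u) (hM : ∀ i, f i ≤ M)
    (hmono : ∀ i j, i ≤ j → u j ≤ s → f i ≤ f j)
    (hanti : ∀ i j, i ≤ j → s ≤ u i → f j ≤ f i)
    (hs0 : u 0 ≤ s) :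
    ∑ j ∈ Finset.range m, |f (j + 1) - f j| ≤ 2 * M - f m - f 0 := by
  -- Reflecting the descending part in the level `M` makes each increment of `h` dominate the
  -- absolute increment of `f`; the sum then telescopes.
  set h : ℕ → ℝ := fun j => if u j ≤ s then f j else 2 * M - f j with hh
  have step : ∀ j ∈ Finset.range m, |f (j + 1) - f j| ≤ h (j + 1) - h j := by
    intro j _
    have hj : u j ≤ u (j + 1) := hu (Nat.le_succ j)
    have h1 := hM j
    have h2 := hM (j + 1)
    simp only [hh]
    split_ifs with a b b
    · have := hmono j (j + 1) (Nat.le_succ j) a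
      rw [abs_of_nonneg (by linarith)]
    · exact absurd (hj.trans a) b
    · rw [abs_le]; constructor <;> linarith
    · have := hanti j (j + 1) (Nat.le_succ j) (not_le.1 b).le
      rw [abs_le]; constructor <;> linarith
  refine (Finset.sum_le_sum step).trans ?_
  rw [Finset.sum_range_sub]
  simp only [hh, if_pos hs0]
  have := hM m
  split_ifs <;> linarith

/-- A selection of norming functionals along half of an ellipse, extended antipodally
to the endpoint. -/
theorem exists_norming_selection {X : Type*} [NormedAddCommGroup X] [NormedSpace ℝ X]
    (γ : ℝ → X) (hγ : γ Real.pi = -γ 0) :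
    ∃ φ : ℝ → X →L[ℝ] ℝ, (∀ t x, φ t x ≤ ‖x‖) ∧ (∀ t, φ t (γ t) = ‖γ t‖) ∧
      φ Real.pi = -φ 0 := by
  choose ψ hψ1 hψ2 using fun t => exists_dual_vector'' ℝ (γ t)
  have key : ∀ t x, |ψ t x| ≤ ‖x‖ := fun t x =>
    ((ψ t).le_of_opNorm_le (hψ1 t) x).trans (by simp)
  refine ⟨fun t => if t = Real.pi then -ψ 0 else ψ t, fun t x => ?_, fun t => ?_, ?_⟩
  · dsimp only
    split_ifs
    · exact (neg_le_abs _).trans (key 0 x)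
    · exact (le_abs_self _).trans (key t x)
  · dsimp only
    split_ifs with h
    · rw [h, hγ]; simpa using hψ2 0
    · simpa using hψ2 t
  · simp [Real.pi_ne_zero.symm]

/-- For r ≤ s ≤ t ≤ r + π all three sines are nonnegative, so this puts the middle point in the cone
of the outer two. -/
theorem sin_smul_arc_eq {X : Type*} [AddCommGroup X] [Module ℝ X] (e₁ e₂ : X) (r s t : ℝ) :
    Real.sin (t - r) • (Real.cos s • e₁ + Real.sin s • e₂) =
      Real.sin (t - s) • (Real.cos r • e₁ + Real.sin r • e₂) +
      Real.sin (s - r) • (Real.cos t • e₁ + Real.sin t • e₂) := by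
  have h1 : Real.sin (t - r) * Real.cos s =
      Real.sin (t - s) * Real.cos r + Real.sin (s - r) * Real.cos t := by
    simp only [Real.sin_sub]; ring
  have h2 : Real.sin (t - r) * Real.sin s =
      Real.sin (t - s) * Real.sin r + Real.sin (s - r) * Real.sin t := by
    simp only [Real.sin_sub]; ring
  simp only [smul_add, smul_smul]
  rw [h1, h2]
  module

/-- Monotonicity of norming functionals: `q` lies between `p` and `r`. -/
theorem norming_apply_le {X : Type*} [NormedAddCommGroup X] [NormedSpace ℝ X]
    {p q r : X} {a b c : ℝ} (h : c • q = a • p + b • r) (ha : 0 < a) (hb : 0 ≤ b) (hc : 0 ≤ c)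
    {φ ψ : X →L[ℝ] ℝ} (hφ : ∀ x, φ x ≤ ‖x‖) (hψ : ∀ x, ψ x ≤ ‖x‖)
    (hq : φ q = ‖q‖) (hr : ψ r = ‖r‖) : ψ p ≤ φ p := by
  -- `φ` is at least `ψ` at `q` and at most `ψ` at `r`, so the linear relation forces `ψ p ≤ φ p`.
  have h1 : c * φ q = a * φ p + b * φ r := by simpa using congrArg φ h
  have h2 : c * ψ q = a * ψ p + b * ψ r := by simpa using congrArg ψ h
  have h3 : c * ψ q ≤ c * φ q := by rw [hq]; gcongr; exact hψ q
  have h4 : b * φ r ≤ b * ψ r := by rw [hr]; gcongr; exact hφ r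
  exact le_of_mul_le_mul_left (by linarith) ha

theorem exists_arc_coordinates {X : Type*} [NormedAddCommGroup X] [NormedSpace ℝ X]
    (hX : Module.finrank ℝ X = 2) :
    ∃ e₁ e₂ : X, ∀ x : X, ∃ r s : ℝ, 0 ≤ s ∧ s ≤ Real.pi ∧
      x = r • (Real.cos s • e₁ + Real.sin s • e₂) := by
  have : Module.Finite ℝ X := Module.finite_of_finrank_pos (by omega)
  let b := Module.finBasisOfFinrankEq ℝ X hX
  refine ⟨b 0, b 1, ?_⟩
  have pos : ∀ c d : ℝ, 0 ≤ d → ∃ r s : ℝ, 0 ≤ s ∧ s ≤ Real.pi ∧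
      c • b 0 + d • b 1 = r • (Real.cos s • b 0 + Real.sin s • b 1) := by
    intro c d hd
    refine ⟨‖(⟨c, d⟩ : ℂ)‖, Complex.arg ⟨c, d⟩, Complex.arg_nonneg_iff.2 hd,
      Complex.arg_le_pi _, ?_⟩
    rw [smul_add, smul_smul, smul_smul, Complex.norm_mul_cos_arg, Complex.norm_mul_sin_arg]
  intro x
  have hx : x = b.repr x 0 • b 0 + b.repr x 1 • b 1 := by
    rw [← Fin.sum_univ_two (fun i => b.repr x i • b i), b.sum_repr]
  rcases le_total 0 (b.repr x 1) with h | h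
  · obtain ⟨r, s, h0, h1, h2⟩ := pos (b.repr x 0) _ h
    exact ⟨r, s, h0, h1, hx.trans h2⟩
  · obtain ⟨r, s, h0, h1, h2⟩ := pos (-b.repr x 0) (-b.repr x 1) (by linarith)
    refine ⟨-r, s, h0, h1, ?_⟩
    rw [neg_smul, ← h2]
    conv_lhs => rw [hx]
    module

theorem exists_monotone_partition (F : Finset ℝ) (a b : ℝ) (hab : a ≤ b)
    (hF : ∀ t ∈ F, a ≤ t ∧ t ≤ b) :
    ∃ (m : ℕ) (u : ℕ → ℝ), Monotone u ∧ u 0 = a ∧ u m = b ∧ (∀ j, a ≤ u j ∧ u j ≤ b) ∧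
      ∀ t ∈ F, ∃ j ≤ m, u j = t := by
  classical
  induction F using Finset.induction_on_max generalizing b with
  | empty =>
    refine ⟨1, fun j => if j = 0 then a else b, ?_, by simp, by simp, ?_, by simp⟩
    · intro i j hij
      dsimp only
      split_ifs <;> first | exact le_rfl | exact hab | omega
    · intro j
      dsimp only
      split_ifs <;> simp [hab]
  | insert t F hmax ih =>
    obtain ⟨hat, htb⟩ := hF t (Finset.mem_insert_self _ _)
    obtain ⟨m, u, hu, h0, hm, hr, hmem⟩ := ih t hat fun s hs =>
      ⟨(hF s (Finset.mem_insert_of_mem hs)).1, (hmax s hs).le⟩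
    refine ⟨m + 1, fun j => if j ≤ m then u j else b, ?_, by simp [h0], by simp, ?_, ?_⟩
    · intro i j hij
      dsimp only
      split_ifs
      · exact hu hij
      · exact (hr i).2.trans htb
      · omega
      · exact le_rfl
    · intro j
      dsimp only
      split_ifs
      · exact ⟨(hr j).1, (hr j).2.trans htb⟩
      · exact ⟨hab, le_rfl⟩
    · intro s hs
      rcases Finset.mem_insert.1 hs with rfl | hs
      · exact ⟨m, by omega, by simp [hm]⟩
      · obtain ⟨j, hj, rfl⟩ := hmem s hs
        exact ⟨j, by omega, by simp [hj]⟩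

/-- On a two-dimensional space, some `ℓ₁`-type seminorm lies below the norm and agrees
with it at finitely many prescribed points. -/
theorem exists_sum_abs_le_norm {X : Type*} [NormedAddCommGroup X] [NormedSpace ℝ X]
    (hX : Module.finrank ℝ X = 2) {n : ℕ} (x : Fin n → X) :
    ∃ (m : ℕ) (g : ℕ → X →L[ℝ] ℝ), (∀ y, ∑ j ∈ Finset.range m, |g j y| ≤ ‖y‖) ∧
      ∀ i, ‖x i‖ ≤ ∑ j ∈ Finset.range m, |g j (x i)| := by
  classical
  obtain ⟨e₁, e₂, he⟩ := exists_arc_coordinates hX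
  set γ : ℝ → X := fun s => Real.cos s • e₁ + Real.sin s • e₂ with hγ
  obtain ⟨φ, hφ, hφγ, hφπ⟩ := exists_norming_selection γ (by simp [hγ])
  choose r s hs0 hs1 hx using fun i => he (x i)
  obtain ⟨m, u, hu, hu0, hum, hur, hmem⟩ := exists_monotone_partition
    (Finset.univ.image s) 0 Real.pi Real.pi_pos.le (by simpa using fun i => ⟨hs0 i, hs1 i⟩)
  have hdiff : ∀ j (c : ℝ) (y : X), |((1 / 2 : ℝ) • (φ (u (j + 1)) - φ (u j))) (c • y)| =
      |c| / 2 * |φ (u (j + 1)) y - φ (u j) y| := by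
    intro j c y
    simp only [smul_apply, sub_apply, map_smul, smul_eq_mul]
    rw [abs_mul, abs_mul, abs_of_pos (by norm_num : (0 : ℝ) < 1 / 2)]
    ring
  -- The sum is half the variation of `φ (u j) y`, which rises to at most ‖y‖ and falls back;
  -- antipodal endpoint values cancel.
  refine ⟨m, fun j => (1 / 2 : ℝ) • (φ (u (j + 1)) - φ (u j)), fun y => ?_, fun i => ?_⟩
  · obtain ⟨c, t, ht0, ht1, rfl⟩ := he y
    change ∑ j ∈ Finset.range m, |((1 / 2 : ℝ) • (φ (u (j + 1)) - φ (u j))) (c • γ t)| ≤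
      ‖c • γ t‖
    simp only [hdiff]
    rw [← Finset.mul_sum, norm_smul, Real.norm_eq_abs]
    have hpp : φ Real.pi (γ t) = -φ 0 (γ t) := by rw [hφπ]; rfl
    have := sum_abs_sub_le_of_unimodal (f := fun j => φ (u j) (γ t)) (s := t) (M := ‖γ t‖)
      (m := m) hu (fun j => hφ _ _) ?_ ?_ (hu0.trans_le ht0)
    · rw [hu0, hum, hpp] at this
      have hc := abs_nonneg c
      calc _ ≤ |c| / 2 * (2 * ‖γ t‖ - -φ 0 (γ t) - φ 0 (γ t)) := by gcongr
        _ = _ := by ring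
    · intro i j hij hj
      rcases (hu hij).eq_or_lt with h | h
      · rw [h]
      have h0 := (hur i).1
      by_cases hπ : u j - u i < Real.pi
      · refine norming_apply_le (p := γ t) (q := γ (u j)) (r := γ (u i))
          (a := Real.sin (u j - u i)) (b := Real.sin (t - u j)) (c := Real.sin (t - u i))
          ?_ (Real.sin_pos_of_pos_of_lt_pi (by linarith) hπ)
          (Real.sin_nonneg_of_nonneg_of_le_pi (by linarith) (by linarith))
          (Real.sin_nonneg_of_nonneg_of_le_pi (by linarith) (by linarith))
          (hφ _) (hφ _) (hφγ _) (hφγ _)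
        rw [add_comm]
        exact sin_smul_arc_eq e₁ e₂ (u i) (u j) t
      -- The sine coefficient vanishes here, but then `u j = t = π`, where `φ` norms `γ t`.
      · have : u j = t := by linarith
        rw [this, hφγ]
        exact hφ _ _
    · intro i j hij hj
      rcases (hu hij).eq_or_lt with h | h
      · rw [h]
      have h0 := (hur j).2
      by_cases hπ : u j - u i < Real.pi
      · exact norming_apply_le (p := γ t) (q := γ (u i)) (r := γ (u j))
          (a := Real.sin (u j - u i)) (b := Real.sin (u i - t)) (c := Real.sin (u j - t))
          (sin_smul_arc_eq e₁ e₂ t (u i) (u j))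
          (Real.sin_pos_of_pos_of_lt_pi (by linarith) hπ)
          (Real.sin_nonneg_of_nonneg_of_le_pi (by linarith) (by linarith))
          (Real.sin_nonneg_of_nonneg_of_le_pi (by linarith) (by linarith))
          (hφ _) (hφ _) (hφγ _) (hφγ _)
      · have : u i = t := by linarith
        rw [this, hφγ]
        exact hφ _ _
  · obtain ⟨k, hk, hks⟩ := hmem (s i) (Finset.mem_image_of_mem s (Finset.mem_univ i))
    have hxi : x i = r i • γ (s i) := hx i
    rw [hxi]
    simp only [hdiff]
    rw [← Finset.mul_sum, norm_smul, Real.norm_eq_abs]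
    have hc := abs_nonneg (r i)
    set f : ℕ → ℝ := fun j => φ (u j) (γ (s i)) with hf
    -- At a partition point the peak ‖γ (s i)‖ is attained, so the climb and the descent alone give
    -- variation 2‖γ (s i)‖.
    have h1 := dist_le_range_sum_dist f k
    have h2 := dist_le_Ico_sum_dist f hk
    have h3 := Finset.sum_range_add_sum_Ico (fun j => dist (f j) (f (j + 1))) hk
    have hfk : f k = ‖γ (s i)‖ := by simp only [hf, hks, hφγ]
    have hfm : f m = -f 0 := by simp only [hf, hum, hu0, hφπ]; rfl
    have hsum : ∑ j ∈ Finset.range m, |f (j + 1) - f j| =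
        ∑ j ∈ Finset.range m, dist (f j) (f (j + 1)) :=
      Finset.sum_congr rfl fun j _ => by rw [dist_comm, Real.dist_eq]
    have h4 : f k - f 0 ≤ dist (f 0) (f k) := by
      rw [dist_comm, Real.dist_eq]; exact le_abs_self _
    have h5 : f k - f m ≤ dist (f k) (f m) := by
      rw [Real.dist_eq]; exact le_abs_self _
    have h6 : 2 * ‖γ (s i)‖ ≤ ∑ j ∈ Finset.range m, |f (j + 1) - f j| := by
      rw [hsum, ← h3]; linarith
    calc |r i| * ‖γ (s i)‖ = |r i| / 2 * (2 * ‖γ (s i)‖) := by ring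
      _ ≤ _ := by gcongr

/-! ### Functionals and the projective norm -/

theorem le_mul_projectiveNorm {E F : Type*} [NormedAddCommGroup E] [NormedSpace ℝ E]
    [NormedAddCommGroup F] [NormedSpace ℝ F] (G : E ⊗[ℝ] F →ₗ[ℝ] ℝ) {C : ℝ} (hC : 0 ≤ C)
    (hG : ∀ x y, G (x ⊗ₜ y) ≤ C * (‖x‖ * ‖y‖)) (u : E ⊗[ℝ] F) :
    G u ≤ C * projectiveNorm u := by
  have key : ∀ r ∈ projectiveCosts u, G u ≤ C * r := by
    rintro r ⟨n, x, y, rfl, rfl⟩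
    rw [map_sum, Finset.mul_sum]
    exact Finset.sum_le_sum fun i _ => hG _ _
  refine le_of_forall_pos_le_add fun ε hε => ?_
  obtain ⟨r, hr, hr'⟩ := exists_lt_of_csInf_lt (projectiveCosts_nonempty u)
    (show projectiveNorm u < projectiveNorm u + ε / (C + 1) by
      linarith [div_pos hε (by linarith : 0 < C + 1)])
  have h1 : C * r ≤ C * (projectiveNorm u + ε / (C + 1)) := by gcongr
  have h2 : C * (ε / (C + 1)) ≤ ε := by
    rw [mul_div_assoc', div_le_iff₀ (by linarith)]; linarith
  linarith [key r hr]

namespace ProjectiveTensorProduct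

variable {E F : Type*} [NormedAddCommGroup E] [NormedSpace ℝ E]
  [NormedAddCommGroup F] [NormedSpace ℝ F]

/-- The canonical linear map from the algebraic tensor product into its completion. -/
noncomputable def ofTensor : E ⊗[ℝ] F →ₗ[ℝ] ProjectiveTensorProduct E F :=
  (UniformSpace.Completion.toComplₗᵢ (𝕜 := ℝ) (E := AlgProjectiveTensor E F)).toLinearMap

theorem norm_ofTensor (u : E ⊗[ℝ] F) : ‖ofTensor u‖ = projectiveNorm u :=
  UniformSpace.Completion.norm_coe (E := AlgProjectiveTensor E F) u

theorem norm_ofTensor_tmul_le (x : E) (y : F) : ‖ofTensor (x ⊗ₜ[ℝ] y)‖ ≤ ‖x‖ * ‖y‖ :=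
  (norm_ofTensor _).trans_le
    (csInf_le (projectiveCosts_bddBelow _) (projectiveCosts_tmul x y))

theorem opNorm_le_of_tmul (f : ProjectiveTensorProduct E F →L[ℝ] ℝ) {C : ℝ} (hC : 0 ≤ C)
    (hf : ∀ x y, f (ofTensor (x ⊗ₜ[ℝ] y)) ≤ C * (‖x‖ * ‖y‖)) : ‖f‖ ≤ C := by
  refine f.opNorm_le_bound hC fun z => ?_
  have key : ∀ z, f z ≤ C * ‖z‖ := by
    intro z
    induction z using UniformSpace.Completion.induction_on with
    | hp => exact isClosed_le f.continuous (continuous_const.mul continuous_norm)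
    | ih u =>
      refine (le_mul_projectiveNorm (f.toLinearMap ∘ₗ ofTensor) hC hf u).trans_eq ?_
      exact congrArg (C * ·) (norm_ofTensor (E := E) (F := F) u).symm
  rw [Real.norm_eq_abs, abs_le']
  exact ⟨key z, by simpa using key (-z)⟩

/-- The norm of a functional is approximated on elementary tensors of the unit balls. -/
theorem exists_tmul_lt (f : ProjectiveTensorProduct E F →L[ℝ] ℝ) {c : ℝ} (hc : c < ‖f‖) :
    ∃ (x : E) (y : F), ‖x‖ ≤ 1 ∧ ‖y‖ ≤ 1 ∧ c < f (ofTensor (x ⊗ₜ[ℝ] y)) := by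
  by_contra! H
  have hc0 : 0 ≤ c := by simpa using H 0 0 (by simp) (by simp)
  refine hc.not_ge (opNorm_le_of_tmul f hc0 fun x y => ?_)
  rcases eq_or_ne x 0 with rfl | hx
  · simp
  rcases eq_or_ne y 0 with rfl | hy
  · simp
  have hx' : 0 < ‖x‖ := norm_pos_iff.2 hx
  have hy' : 0 < ‖y‖ := norm_pos_iff.2 hy
  have h := H (‖x‖⁻¹ • x) (‖y‖⁻¹ • y) (by simp [norm_smul, hx]) (by simp [norm_smul, hy])
  rw [TensorProduct.smul_tmul_smul, map_smul, map_smul, smul_eq_mul, ← mul_inv,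
    inv_mul_le_iff₀ (by positivity)] at h
  linarith

end ProjectiveTensorProduct

/-! ### Coordinates in c₀ -/

namespace ZeroAtInftyContinuousMap

theorem norm_le_iff_forall {C : ℝ} (hC : 0 ≤ C) (a : C₀(ℕ, ℝ)) :
    ‖a‖ ≤ C ↔ ∀ k, |a k| ≤ C := by
  rw [← norm_toBCF_eq_norm, BoundedContinuousFunction.norm_le hC]
  rfl

theorem abs_apply_le_norm (a : C₀(ℕ, ℝ)) (k : ℕ) : |a k| ≤ ‖a‖ :=
  (norm_le_iff_forall (norm_nonneg a) a).1 le_rfl k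

/-- Evaluation at a coordinate, as a linear form on `c₀`. -/
def coord (k : ℕ) : C₀(ℕ, ℝ) →ₗ[ℝ] ℝ where
  toFun a := a k
  map_add' _ _ := rfl
  map_smul' _ _ := rfl

/-- The unit vectors of `c₀`. -/
def unitVec (k : ℕ) : C₀(ℕ, ℝ) where
  toFun i := if i = k then 1 else 0
  continuous_toFun := continuous_of_discreteTopology
  zero_at_infty' := by
    rw [Filter.cocompact_eq_cofinite]
    refine tendsto_const_nhds.congr' ?_
    filter_upwards [(Set.finite_singleton k).compl_mem_cofinite] with i hi
    rw [if_neg (by simpa using hi)]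

theorem coord_unitVec (i k : ℕ) : coord i (unitVec k) = if i = k then 1 else 0 := rfl

theorem coord_sum_unitVec (s : Finset ℕ) (c : ℕ → ℝ) (k : ℕ) :
    coord k (∑ j ∈ s, c j • unitVec j) = if k ∈ s then c k else 0 := by
  simp [coord_unitVec]

/-- Finite sign vectors lie in the unit ball of c₀, so testing on them bounds every partial sum by
`C`. -/
theorem summable_abs_apply_unitVec (φ : C₀(ℕ, ℝ) →ₗ[ℝ] ℝ) {C : ℝ}
    (hφ : ∀ a, φ a ≤ C * ‖a‖) : Summable fun k => |φ (unitVec k)| := by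
  have hC : 0 ≤ C := by
    have h1 := hφ (unitVec 0)
    have h2 := hφ (-unitVec 0)
    rw [map_neg, norm_neg] at h2
    have h3 := abs_apply_le_norm (unitVec 0) 0
    have h4 : |unitVec 0 0| = 1 := by change |(if 0 = 0 then (1 : ℝ) else 0)| = 1; simp
    by_contra! h
    nlinarith
  refine summable_of_sum_le (c := C) (fun _ => abs_nonneg _) fun s => ?_
  have h : ∑ k ∈ s, |φ (unitVec k)| =
      φ (∑ k ∈ s, (SignType.sign (φ (unitVec k)) : ℝ) • unitVec k) := by
    simp [map_sum, sign_mul_self]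
  rw [h]
  refine (hφ _).trans (mul_le_of_le_one_right hC ((norm_le_iff_forall zero_le_one _).2 ?_))
  intro k
  change |coord k _| ≤ 1
  rw [coord_sum_unitVec]
  split_ifs
  · cases SignType.sign (φ (unitVec k)) <;> simp
  · simp

/-- Replace the coordinates of `a` in the finite set `s` by those of `c`. -/
def replaceOn (a : C₀(ℕ, ℝ)) (s : Finset ℕ) (c : ℕ → ℝ) : C₀(ℕ, ℝ) :=
  a + ∑ k ∈ s, (c k - a k) • unitVec k

theorem coord_replaceOn (a : C₀(ℕ, ℝ)) (s : Finset ℕ) (c : ℕ → ℝ) (k : ℕ) :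
    coord k (replaceOn a s c) = if k ∈ s then c k else a k := by
  rw [replaceOn, map_add, coord_sum_unitVec]
  change a k + _ = _
  split_ifs <;> simp

theorem norm_replaceOn_le_one {a : C₀(ℕ, ℝ)} (ha : ‖a‖ ≤ 1) (s : Finset ℕ) {c : ℕ → ℝ}
    (hc : ∀ k, |c k| ≤ 1) : ‖replaceOn a s c‖ ≤ 1 := by
  refine (norm_le_iff_forall zero_le_one _).2 fun k => ?_
  change |coord k (replaceOn a s c)| ≤ 1
  rw [coord_replaceOn]
  split_ifs
  · exact hc k
  · exact (abs_apply_le_norm a k).trans ha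

theorem sub_le_apply_replaceOn (φ : C₀(ℕ, ℝ) →ₗ[ℝ] ℝ) {a : C₀(ℕ, ℝ)} (ha : ‖a‖ ≤ 1)
    (s : Finset ℕ) {c : ℕ → ℝ} (hc : ∀ k, |c k| ≤ 1) :
    φ a - 2 * ∑ k ∈ s, |φ (unitVec k)| ≤ φ (replaceOn a s c) := by
  have h : -φ (∑ k ∈ s, (c k - a k) • unitVec k) ≤ 2 * ∑ k ∈ s, |φ (unitVec k)| := by
    rw [map_sum, Finset.mul_sum, ← Finset.sum_neg_distrib]
    refine Finset.sum_le_sum fun k _ => ?_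
    rw [map_smul, smul_eq_mul]
    refine (neg_le_abs _).trans ?_
    rw [abs_mul]
    gcongr
    linarith [abs_sub (c k) (a k), hc k, (abs_apply_le_norm a k).trans ha]
  rw [replaceOn, map_add]
  linarith

end ZeroAtInftyContinuousMap

/-! ### Combinations of slices -/

section SliceCombinations

variable {E : Type*} [NormedAddCommGroup E] [NormedSpace ℝ E]

theorem norm_le_one_of_mem_setCombination {n : ℕ} {w : Fin n → ℝ} {S : Fin n → Set E}
    (hw : ∀ i, 0 ≤ w i) (hw1 : ∑ i, w i = 1) (hS : ∀ i, IsUnitBallSlice (S i)) {z : E}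
    (hz : z ∈ setCombination w S) : ‖z‖ ≤ 1 := by
  obtain ⟨x, hx, rfl⟩ := hz
  rw [← hw1]
  refine norm_sum_le_of_le _ fun i _ => ?_
  obtain ⟨f, α, -, -, h⟩ := hS i
  have hxi := hx i
  rw [h] at hxi
  rw [norm_smul, Real.norm_of_nonneg (hw i)]
  exact mul_le_of_le_one_right (hw i) (mem_closedBall_zero_iff.1 hxi.1)

theorem dist_le_two_of_mem_setCombination {n : ℕ} {w : Fin n → ℝ} {S : Fin n → Set E}
    (hw : ∀ i, 0 ≤ w i) (hw1 : ∑ i, w i = 1) (hS : ∀ i, IsUnitBallSlice (S i)) :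
    ∀ y ∈ setCombination w S, ∀ z ∈ setCombination w S, dist y z ≤ 2 := by
  intro y hy z hz
  rw [dist_eq_norm]
  linarith [norm_sub_le y z, norm_le_one_of_mem_setCombination hw hw1 hS hy,
    norm_le_one_of_mem_setCombination hw hw1 hS hz]

end SliceCombinations

open ZeroAtInftyContinuousMap ProjectiveTensorProduct in
theorem exists_le_dist_of_slices {X : Type*} [NormedAddCommGroup X] [NormedSpace ℝ X]
    (hX : Module.finrank ℝ X = 2) {n : ℕ} {w : Fin n → ℝ} (hw : ∀ i, 0 ≤ w i)
    (hw1 : ∑ i, w i = 1) {S : Fin n → Set (ProjectiveTensorProduct C₀(ℕ, ℝ) X)}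
    (hS : ∀ i, IsUnitBallSlice (S i)) {ε : ℝ} (hε : 0 < ε) :
    ∃ y ∈ setCombination w S, ∃ z ∈ setCombination w S, 2 * (1 - ε) ≤ dist y z := by
  choose f α hf hα hSf using hS
  -- The minimum secures both membership in the slice and `‖x i‖ ≥ 1 - ε`.
  have hlt : ∀ i, 1 - min (α i) ε < ‖f i‖ := fun i => by
    rw [hf i]; linarith [lt_min (hα i) hε]
  choose a x ha hx hax using fun i => exists_tmul_lt (f i) (hlt i)
  have hxε : ∀ i, 1 - ε ≤ ‖x i‖ := fun i => by
    have h1 : f i (ofTensor (a i ⊗ₜ x i)) ≤ 1 * (‖a i‖ * ‖x i‖) :=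
      (le_abs_self _).trans (((f i).le_of_opNorm_le (hf i).le _).trans
        (by gcongr; exact norm_ofTensor_tmul_le _ _))
    have h2 : ‖a i‖ * ‖x i‖ ≤ ‖x i‖ := mul_le_of_le_one_left (norm_nonneg _) (ha i)
    linarith [hax i, min_le_right (α i) ε]
  obtain ⟨m, g, hg, hgx⟩ := exists_sum_abs_le_norm hX x
  let φ : Fin n → C₀(ℕ, ℝ) →ₗ[ℝ] ℝ := fun i =>
    (f i).toLinearMap ∘ₗ ofTensor ∘ₗ (TensorProduct.mk ℝ C₀(ℕ, ℝ) X).flip (x i)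
  have hφ : ∀ i b, φ i b ≤ 1 * ‖b‖ := fun i b =>
    (le_abs_self _).trans (((f i).le_of_opNorm_le (hf i).le _).trans (by
      gcongr
      exact (norm_ofTensor_tmul_le _ _).trans (mul_le_of_le_one_right (norm_nonneg _) (hx i))))
  have htail : ∀ i, Filter.Tendsto
      (fun N => ∑ j ∈ Finset.range m, |φ i (unitVec (N + j))|) Filter.atTop (nhds 0) := by
    intro i
    have h0 := (summable_abs_apply_unitVec (φ i) (hφ i)).tendsto_atTop_zero
    simpa using tendsto_finsetSum (Finset.range m) fun j _ =>
      h0.comp (Filter.tendsto_add_atTop_nat j)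
  -- Half the slack suffices: overwriting coordinates costs at most twice the block sum.
  obtain ⟨N, hN⟩ := (Filter.eventually_all.2 fun i => (htail i).eventually_lt_const
    (show 0 < (φ i (a i) - (1 - min (α i) ε)) / 2 from
      half_pos (sub_pos.2 (hax i)))).exists
  let s := Finset.Ico N (N + m)
  have hs : ∀ i, ∑ k ∈ s, |φ i (unitVec k)| < (φ i (a i) - (1 - min (α i) ε)) / 2 := by
    intro i
    rw [Finset.sum_Ico_eq_sum_range, Nat.add_sub_cancel_left]
    exact hN i
  let c : ℝ → Fin n → ℕ → ℝ := fun σ i k => σ * SignType.sign (g (k - N) (x i))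
  have hc : ∀ σ, |σ| = 1 → ∀ i k, |c σ i k| ≤ 1 := by
    intro σ hσ i k
    simp only [c, abs_mul, hσ, one_mul]
    cases SignType.sign (g (k - N) (x i)) <;> simp
  let u : ℝ → Fin n → C₀(ℕ, ℝ) ⊗[ℝ] X := fun σ i => replaceOn (a i) s (c σ i) ⊗ₜ x i
  have hu : ∀ σ, |σ| = 1 → ∀ i, ofTensor (u σ i) ∈ S i := by
    intro σ hσ i
    rw [hSf i]
    refine ⟨mem_closedBall_zero_iff.2 ((norm_ofTensor_tmul_le _ _).trans ?_), ?_⟩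
    · exact mul_le_one₀ (norm_replaceOn_le_one (ha i) s (hc σ hσ i)) (norm_nonneg _) (hx i)
    · have h := sub_le_apply_replaceOn (φ i) (ha i) s (hc σ hσ i)
      change _ < φ i (replaceOn (a i) s (c σ i))
      linarith [hs i, min_le_left (α i) ε]
  -- One coordinate per `g j`: on `b ⊗ y` it is at most ‖b‖ ∑ |g j y| ≤ ‖b‖‖y‖.
  let G : C₀(ℕ, ℝ) ⊗[ℝ] X →ₗ[ℝ] ℝ := ∑ j ∈ Finset.range m,
    LinearMap.mul' ℝ ℝ ∘ₗ TensorProduct.map (coord (N + j)) (g j).toLinearMap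
  have hG : ∀ b y, G (b ⊗ₜ y) = ∑ j ∈ Finset.range m, coord (N + j) b * g j y := by
    intro b y
    simp [G]
  have hGle : ∀ v, G v ≤ ‖ofTensor v‖ := by
    intro v
    rw [norm_ofTensor, ← one_mul (projectiveNorm v)]
    refine le_mul_projectiveNorm G zero_le_one (fun b y => ?_) v
    rw [hG, one_mul]
    calc ∑ j ∈ Finset.range m, coord (N + j) b * g j y
        ≤ ∑ j ∈ Finset.range m, ‖b‖ * |g j y| := by
          refine Finset.sum_le_sum fun j _ => (le_abs_self _).trans ?_
          rw [abs_mul]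
          gcongr
          exact abs_apply_le_norm b _
      _ ≤ ‖b‖ * ‖y‖ := by
          rw [← Finset.mul_sum]
          gcongr
          exact hg y
  have hGu : ∀ σ i, G (u σ i) = σ * ∑ j ∈ Finset.range m, |g j (x i)| := by
    intro σ i
    rw [hG, Finset.mul_sum]
    refine Finset.sum_congr rfl fun j hj => ?_
    have hmem : N + j ∈ s := by
      have := Finset.mem_range.1 hj
      exact Finset.mem_Ico.2 ⟨by omega, by omega⟩
    rw [coord_replaceOn, if_pos hmem]
    simp only [c, Nat.add_sub_cancel_left]
    rw [mul_assoc, sign_mul_self]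
  refine ⟨_, ⟨fun i => ofTensor (u 1 i), hu 1 (by simp), rfl⟩,
    _, ⟨fun i => ofTensor (u (-1) i), hu (-1) (by simp), rfl⟩, ?_⟩
  have hdist : ∑ i, w i • ofTensor (u 1 i) - ∑ i, w i • ofTensor (u (-1) i) =
      ofTensor (∑ i, w i • (u 1 i - u (-1) i)) := by
    simp only [map_sum, map_smul, map_sub, smul_sub, Finset.sum_sub_distrib]
  rw [dist_eq_norm, hdist]
  refine le_trans ?_ (hGle _)
  simp only [map_sum, map_smul, map_sub, hGu, smul_eq_mul]
  calc 2 * (1 - ε) = ∑ i, w i * (2 * (1 - ε)) := by rw [← Finset.sum_mul, hw1, one_mul]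
    _ ≤ _ := by
      refine Finset.sum_le_sum fun i _ => mul_le_mul_of_nonneg_left ?_ (hw i)
      linarith [hxε i, hgx i]

theorem mainTheorem12 {X : Type*} [NormedAddCommGroup X] [NormedSpace ℝ X]
    (hX : Module.finrank ℝ X = 2) :
    StrongDiameterTwoProperty (ProjectiveTensorProduct C₀(ℕ, ℝ) X) := by
  intro n w S hw hw1 hS
  have hle := dist_le_two_of_mem_setCombination hw hw1 hS
  refine le_antisymm (Metric.diam_le_of_forall_dist_le zero_le_two hle) ?_
  refine le_of_forall_pos_le_add fun ε hε => ?_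
  obtain ⟨y, hy, z, hz, h⟩ := exists_le_dist_of_slices hX hw hw1 hS (half_pos hε)
  have := Metric.dist_le_diam_of_mem (Metric.isBounded_iff.2 ⟨2, fun _ hy _ hz => hle _ hy _ hz⟩)
    hy hz
  linarith
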